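/- For positive integers $m,n$ let $\mathbb{M}_{m\times n}(\mathbb{C})$ be the space of complex $m\times n$ matrices, let $\sigma_1(A)\ge\sigma_2(A)\ge\cdots\ge\sigma_{\min\{m,n\}}(A)\ge 0$ denote the singular values of $A$, and for $1\le p<\infty$ and $1\le k\le\min\{m,n\}$ let $\|A\|_{(p,k)}=\left(\sigma_1^p(A)+\cdots+\sigma_k^p(A)\right)^{1/p}$ be the Ky Fan $p$-$k$ norm. For a complex subspace $\mathcal{M}$ of $\mathbb{M}_{m\times n}(\mathbb{C})$ let $\mathcal{M}^\perp=\{G\in\mathbb{M}_{m\times n}(\mathbb{C}):\operatorname{tr}(B^*G)=0\text{ for all }B\in\mathcal{M}\}$. A density matrix is a positive semidefinite matrix with trace $1$. Theorem. Let $2\le p<\infty$ and $1\le k\le\min\{m,n\}$, let $A\in\mathbb{M}_{m\times n}(\mathbb{C})$, and let $\mathcal{M}$ be a (complex) subspace of $\mathbb{M}_{m\times n}(\mathbb{C})$. Suppose that $$\|A\|_{(p,k)}\le\|A+B\|_{(p,k)}\quad\text{for all }B\in\mathcal{M}.$$ Then there exist density matrices $T_1,\dots,T_k\in\mathbb{M}_{n\times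 n}(\mathbb{C})$ such that $A^*AT_i=\sigma_i^2(A)\,T_i$ for each $1\le i\le k$ and $$\frac{1}{\|A\|_{(p,k)}^{p-1}}\,A(A^*A)^{\frac{p-2}{2}}\sum_{i=1}^kT_i\in\mathcal{M}^\perp.$$ Here $(A^*A)^{0}$ is the identity matrix, and for $A=0$ the last matrix is read as the zero matrix. -/

import Mathlib

open scoped Matrix ComplexOrder

namespace KyFan

/-- The singular values of a complex `m × n` matrix in non-increasing order, indexed from `0`
(so `singularValue A i` is `σ_{i+1}(A)`): the singular values of `A` as a linear map between the
Euclidean spaces `ℂⁿ → ℂᵐ`. -/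
noncomputable def singularValue {m n : ℕ} (A : Matrix (Fin m) (Fin n) ℂ) (i : ℕ) : ℝ :=
  (Matrix.toEuclideanLin A).singularValues i

/-- The Ky Fan `p`-`k` norm `(σ₁(A)^p + ⋯ + σ_k(A)^p)^(1/p)`. -/
noncomputable def pkNorm (p : ℝ) (k : ℕ) {m n : ℕ} (A : Matrix (Fin m) (Fin n) ℂ) : ℝ :=
  (∑ i ∈ Finset.range k, singularValue A i ^ p) ^ (1 / p)

/-- The real power `H ^ r` of a positive semidefinite matrix, by functional calculus: apply
`x ↦ x ^ r` to the eigenvalues. For `r = 0` this is the identity matrix. -/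
noncomputable def matrixPow {n : ℕ} (H : Matrix (Fin n) (Fin n) ℂ) (r : ℝ) :
    Matrix (Fin n) (Fin n) ℂ :=
  cfc (fun x : ℝ => x ^ r) H

/-- A density matrix: positive semidefinite with trace one. -/
def IsDensityMatrix {n : ℕ} (T : Matrix (Fin n) (Fin n) ℂ) : Prop :=
  T.PosSemidef ∧ T.trace = 1

/-- The orthogonal complement of a complex subspace of matrices with respect to the trace inner
product `⟨B, G⟩ = tr(B* G)`. -/
def orthogonalComplement {m n : ℕ} (M : Submodule ℂ (Matrix (Fin m) (Fin n) ℂ)) :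
    Submodule ℂ (Matrix (Fin m) (Fin n) ℂ) where
  carrier := {G | ∀ B ∈ M, (Bᴴ * G).trace = 0}
  add_mem' := by
    intro G G' hG hG' B hB
    rw [Matrix.mul_add, Matrix.trace_add, hG B hB, hG' B hB, add_zero]
  zero_mem' := by
    intro B _
    simp
  smul_mem' := by
    intro c G hG B hB
    rw [Matrix.mul_smul, Matrix.trace_smul, hG B hB, smul_zero]

end KyFan

/-!
Write `⟪·, ·⟫` for inner products and `v₁, …, v_k` for orthonormal leading right singular vectors.
Given `B ∈ M`, convexity of `‖·‖ ^ p` and the maximality of `∑ ‖T vᵢ‖ ^ p` at the leading right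
singular vectors of `T` show that those of `A + t B`, `t > 0`, satisfy
`0 ≤ re ∑ σᵢ(A + t B) ^ (p - 2) ⟪(A + t B) vᵢ, B vᵢ⟫`. Orthonormal families form a compact set and
singular values are continuous, so the inequality passes to some leading right singular vectors of
`A` as `t → 0`; with `Tᵢ = vᵢ vᵢ*` it reads `0 ≤ re tr (B* A (A* A) ^ ((p - 2) / 2) ∑ Tᵢ)`.
The `vᵢ` depend on `B`, but the matrices `A (A* A) ^ ((p - 2) / 2) ∑ Tᵢ`, with `Tᵢ` ranging over the
density matrices such that `A* A Tᵢ = σᵢ(A) ^ 2 Tᵢ`, form a compact convex set. If it missed `M^⊥`,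
Hahn–Banach would produce a single `B ∈ M` violating all of these inequalities.
-/

namespace KyFan

open Filter Module Set Topology
open scoped InnerProductSpace

theorem sum_mul_le_sum_range_of_antitone {n k : ℕ} {s : ℕ → ℝ} (hs : Antitone s) {c : Fin n → ℝ}
    (hc0 : ∀ j, 0 ≤ c j) (hc1 : ∀ j, c j ≤ 1) (hc : ∑ j, c j = k) :
    ∑ j : Fin n, s j * c j ≤ ∑ i ∈ Finset.range k, s i := by
  have hkn : k ≤ n := by
    have : (k : ℝ) ≤ n := by
      simpa [hc] using Finset.sum_le_sum fun j (_ : j ∈ Finset.univ) => hc1 j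
    exact_mod_cast this
  -- Subtracting the constant `s (k - 1)` makes the terms with `j < k` nonnegative and the others
  -- nonpositive.
  have hshift : ∑ j : Fin n, (s j - s (k - 1)) * c j ≤ ∑ i ∈ Finset.range k, (s i - s (k - 1)) :=
    calc ∑ j : Fin n, (s j - s (k - 1)) * c j
        ≤ ∑ j : Fin n, if (j : ℕ) < k then s j - s (k - 1) else 0 := by
          refine Finset.sum_le_sum fun j _ => ?_
          split_ifs with hj
          · exact mul_le_of_le_one_right (sub_nonneg.2 (hs (by omega))) (hc1 j)
          · exact mul_nonpos_of_nonpos_of_nonneg (sub_nonpos.2 (hs (by omega))) (hc0 j)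
      _ = ∑ i ∈ Finset.range k, (s i - s (k - 1)) := by
          rw [Fin.sum_univ_eq_sum_range (fun i => if i < k then s i - s (k - 1) else 0) n,
            ← Finset.sum_filter]
          congr 1
          grind
  simp only [sub_mul, Finset.sum_sub_distrib, ← Finset.mul_sum, hc, Finset.sum_const,
    Finset.card_range, nsmul_eq_mul] at hshift
  linarith

section InnerProductSpace

variable {𝕜 E : Type*} [RCLike 𝕜] [NormedAddCommGroup E] [InnerProductSpace 𝕜 E]

-- The subgradient inequality at `x` of the convex function `‖·‖ ^ p`.
theorem norm_rpow_sub_norm_sub_rpow_le {p : ℝ} (hp : 1 ≤ p) (x y : E) :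
    ‖x‖ ^ p - ‖x - y‖ ^ p ≤ p * (‖x‖ ^ (p - 2) * RCLike.re ⟪x, y⟫_𝕜) := by
  have hp0 : 0 < p := by linarith
  rcases eq_or_ne x 0 with rfl | hx
  · simp [Real.zero_rpow hp0.ne', Real.rpow_nonneg]
  have hx' : 0 < ‖x‖ := norm_pos_iff.2 hx
  have hyoung : ‖x‖ ^ (p - 1) * ‖x - y‖ ≤ (p - 1) / p * ‖x‖ ^ p + 1 / p * ‖x - y‖ ^ p := by
    have h := Real.geom_mean_le_arith_mean2_weighted (div_nonneg (sub_nonneg.2 hp) hp0.le)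
      (one_div_nonneg.2 hp0.le) (Real.rpow_nonneg (norm_nonneg x) p)
      (Real.rpow_nonneg (norm_nonneg (x - y)) p) (by field_simp; ring)
    rwa [← Real.rpow_mul (norm_nonneg _), ← Real.rpow_mul (norm_nonneg _),
      mul_div_cancel₀ _ hp0.ne', mul_one_div_cancel hp0.ne', Real.rpow_one] at h
  have hcauchy : ‖x‖ ^ 2 - RCLike.re ⟪x, y⟫_𝕜 ≤ ‖x‖ * ‖x - y‖ := by
    simpa [inner_sub_right, inner_self_eq_norm_sq] using re_inner_le_norm (𝕜 := 𝕜) x (x - y)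
  have hpow₁ : ‖x‖ ^ (p - 2) * ‖x‖ = ‖x‖ ^ (p - 1) := by
    rw [← Real.rpow_add_one hx'.ne']; ring_nf
  have hpow₂ : ‖x‖ ^ (p - 2) * ‖x‖ ^ 2 = ‖x‖ ^ p := by
    rw [← Real.rpow_add_natCast hx'.ne']; norm_num
  have h := mul_le_mul_of_nonneg_left hcauchy (Real.rpow_nonneg hx'.le (p - 2))
  rw [mul_sub, hpow₂, ← mul_assoc, hpow₁] at h
  have hscaled := mul_le_mul_of_nonneg_left (h.trans hyoung) hp0.le
  field_simp at hscaled
  linarith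

variable (𝕜) in
theorem isCompact_setOf_orthonormal [FiniteDimensional 𝕜 E] (ι : Type*) [Finite ι] :
    IsCompact {v : ι → E | Orthonormal 𝕜 v} := by
  have := Fintype.ofFinite ι
  classical
  have : ProperSpace E := FiniteDimensional.proper 𝕜 E
  refine (isCompact_closedBall (0 : ι → E) 1).of_isClosed_subset ?_ fun v hv => ?_
  · simp only [orthonormal_iff_ite, ofPred_forall]
    exact isClosed_iInter fun i => isClosed_iInter fun j =>
      isClosed_eq (by fun_prop) continuous_const
  · rw [mem_closedBall_zero_iff, pi_norm_le_iff_of_nonneg zero_le_one]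
    exact fun i => (hv.1 i).le

theorem exists_ne_zero_forall_inner_eq_zero [FiniteDimensional 𝕜 E] {ι : Type*} [Fintype ι]
    (w : ι → E) (hw : Fintype.card ι < finrank 𝕜 E) : ∃ x : E, x ≠ 0 ∧ ∀ i, ⟪w i, x⟫_𝕜 = 0 := by
  have hker := LinearMap.ker_ne_bot_of_finrank_lt
    (f := LinearMap.pi fun i => innerₛₗ 𝕜 (w i)) (by rwa [finrank_fintype_fun_eq_card])
  obtain ⟨x, hx, hx0⟩ := Submodule.exists_mem_ne_zero_of_ne_bot hker
  exact ⟨x, hx0, fun i => congrFun (LinearMap.mem_ker.1 hx) i⟩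

theorem exists_mem_orthogonal_of_forall_re_inner_nonneg [CompleteSpace E] [NormedSpace ℝ E]
    [IsScalarTower ℝ 𝕜 E] (S : Submodule 𝕜 E) [S.HasOrthogonalProjection] {K : Set E}
    (hKc : IsCompact K) (hKv : Convex ℝ K)
    (h : ∀ b ∈ S, ∃ g ∈ K, 0 ≤ RCLike.re ⟪b, g⟫_𝕜) : ∃ g ∈ K, g ∈ Sᗮ := by
  set P := S.starProjection
  suffices hzero : (0 : E) ∈ P '' K by
    obtain ⟨g, hg, hPg⟩ := hzero
    exact ⟨g, hg, S.starProjection_apply_eq_zero_iff.1 hPg⟩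
  by_contra hnot
  obtain ⟨f, u, hu, hf⟩ := RCLike.geometric_hahn_banach_point_closed (𝕜 := 𝕜)
    (hKv.linear_image (P.restrictScalars ℝ).toLinearMap) (hKc.image P.continuous).isClosed hnot
  set b := (InnerProductSpace.toDual 𝕜 E).symm f
  obtain ⟨g, hg, hbg⟩ := h (-P b) (S.neg_mem (S.starProjection_apply_mem b))
  have hpos : 0 < RCLike.re ⟪P b, g⟫_𝕜 := by
    rw [S.inner_starProjection_left_eq_right, InnerProductSpace.toDual_symm_apply]
    simp only [map_zero] at hu
    exact hu.trans (hf _ ⟨g, hg, rfl⟩)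
  simp only [inner_neg_left, map_neg] at hbg
  linarith

end InnerProductSpace

section SingularValues

variable {𝕜 E F : Type*} [RCLike 𝕜]
  [NormedAddCommGroup E] [InnerProductSpace 𝕜 E] [FiniteDimensional 𝕜 E]
  [NormedAddCommGroup F] [InnerProductSpace 𝕜 F] [FiniteDimensional 𝕜 F]

/-- A family of `k` leading right singular vectors of `T`: orthonormal vectors `v i` with
`T* T (v i) = σᵢ(T)² v i`, the singular values being taken in non-increasing order. The eigenvector
equation is tested against all `x`, which makes it a closed condition on the pair `(T, v)`. -/
structure IsRightSingularFamily (T : E →L[𝕜] F) {k : ℕ} (v : Fin k → E) : Prop where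
  orthonormal : Orthonormal 𝕜 v
  inner_apply : ∀ i x, ⟪T (v i), T x⟫_𝕜 = ((T.singularValues i ^ 2 : ℝ) : 𝕜) * ⟪v i, x⟫_𝕜

namespace IsRightSingularFamily

theorem norm_apply {T : E →L[𝕜] F} {k : ℕ} {v : Fin k → E} (hv : IsRightSingularFamily T v)
    (i : Fin k) : ‖T (v i)‖ = T.singularValues i := by
  have h := hv.inner_apply i (v i)
  rw [inner_self_eq_norm_sq_to_K, inner_self_eq_norm_sq_to_K, hv.orthonormal.1 i] at h
  have hsq : ‖T (v i)‖ ^ 2 = T.singularValues i ^ 2 := by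
    apply RCLike.ofReal_injective (K := 𝕜)
    simpa using h
  exact (sq_eq_sq₀ (norm_nonneg _) (T.toLinearMap.singularValues_nonneg i)).1 hsq

theorem comp_castLE {T : E →L[𝕜] F} {k l : ℕ} {v : Fin l → E} (hv : IsRightSingularFamily T v)
    (hkl : k ≤ l) : IsRightSingularFamily T (v ∘ Fin.castLE hkl) :=
  ⟨hv.orthonormal.comp _ (Fin.castLE_injective hkl), fun i => hv.inner_apply (Fin.castLE hkl i)⟩

theorem norm_sq_apply_eq_sum {T : E →L[𝕜] F} {n : ℕ} {b : OrthonormalBasis (Fin n) 𝕜 E}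
    (hb : IsRightSingularFamily T b) (x : E) :
    ‖T x‖ ^ 2 = ∑ j : Fin n, T.singularValues j ^ 2 * ‖⟪b j, x⟫_𝕜‖ ^ 2 := by
  have h : ⟪T x, T x⟫_𝕜 =
      ∑ j : Fin n, ((T.singularValues j ^ 2 : ℝ) : 𝕜) * (‖⟪b j, x⟫_𝕜‖ : 𝕜) ^ 2 := by
    calc ⟪T x, T x⟫_𝕜 = ⟪T (∑ j, ⟪b j, x⟫_𝕜 • b j), T x⟫_𝕜 := by rw [b.sum_repr']
      _ = _ := by
        simp only [map_sum, map_smul, sum_inner, inner_smul_left, hb.inner_apply, mul_left_comm,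
          RCLike.conj_mul]
  rw [inner_self_eq_norm_sq_to_K] at h
  apply RCLike.ofReal_injective (K := 𝕜)
  simpa using h

theorem singularValues_mul_norm_le {T : E →L[𝕜] F} {n : ℕ} {b : OrthonormalBasis (Fin n) 𝕜 E}
    (hb : IsRightSingularFamily T b) (i : Fin n) {x : E} (hx : ∀ j, i < j → ⟪b j, x⟫_𝕜 = 0) :
    T.singularValues i * ‖x‖ ≤ ‖T x‖ := by
  refine (sq_le_sq₀ (mul_nonneg (T.toLinearMap.singularValues_nonneg i) (norm_nonneg x))
    (norm_nonneg _)).1 ?_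
  rw [mul_pow, ← b.sum_sq_norm_inner_right x, hb.norm_sq_apply_eq_sum, Finset.mul_sum]
  refine Finset.sum_le_sum fun j _ => ?_
  rcases lt_or_ge i j with hij | hij
  · simp [hx j hij]
  · have := T.toLinearMap.singularValues_nonneg i
    have := T.toLinearMap.singularValues_antitone (show (j : ℕ) ≤ i from hij)
    gcongr

theorem norm_apply_le {T : E →L[𝕜] F} {n : ℕ} {b : OrthonormalBasis (Fin n) 𝕜 E}
    (hb : IsRightSingularFamily T b) (i : Fin n) {x : E} (hx : ∀ j, j < i → ⟪b j, x⟫_𝕜 = 0) :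
    ‖T x‖ ≤ T.singularValues i * ‖x‖ := by
  refine (sq_le_sq₀ (norm_nonneg _)
    (mul_nonneg (T.toLinearMap.singularValues_nonneg i) (norm_nonneg x))).1 ?_
  rw [mul_pow, ← b.sum_sq_norm_inner_right x, hb.norm_sq_apply_eq_sum, Finset.mul_sum]
  refine Finset.sum_le_sum fun j _ => ?_
  rcases lt_or_ge j i with hji | hji
  · simp [hx j hji]
  · have := T.toLinearMap.singularValues_nonneg j
    have := T.toLinearMap.singularValues_antitone (show (i : ℕ) ≤ j from hji)
    gcongr

end IsRightSingularFamily

theorem exists_orthonormalBasis_isRightSingularFamily (T : E →L[𝕜] F) :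
    ∃ b : OrthonormalBasis (Fin (finrank 𝕜 E)) 𝕜 E, IsRightSingularFamily T b := by
  have hsymm := T.toLinearMap.isSymmetric_adjoint_comp_self
  refine ⟨hsymm.eigenvectorBasis rfl, OrthonormalBasis.orthonormal _, fun i x => ?_⟩
  have heig : T.toLinearMap.adjoint (T (hsymm.eigenvectorBasis rfl i)) =
      ((T.singularValues i ^ 2 : ℝ) : 𝕜) • hsymm.eigenvectorBasis rfl i := by
    rw [T.toLinearMap.sq_singularValues_fin rfl i]
    exact hsymm.apply_eigenvectorBasis rfl i
  rw [← RCLike.conj_ofReal, ← inner_smul_left, ← heig]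
  exact (T.toLinearMap.adjoint_inner_left _ _).symm

theorem exists_isRightSingularFamily (T : E →L[𝕜] F) {k : ℕ} (hk : k ≤ finrank 𝕜 E) :
    ∃ v : Fin k → E, IsRightSingularFamily T v :=
  let ⟨_, hb⟩ := exists_orthonormalBasis_isRightSingularFamily T
  ⟨_, hb.comp_castLE hk⟩

theorem singularValues_le_add_norm_sub (T S : E →L[𝕜] F) (i : ℕ) :
    T.singularValues i ≤ S.singularValues i + ‖T - S‖ := by
  rcases le_or_gt (finrank 𝕜 E) i with hi | hi
  · simp [LinearMap.singularValues_of_finrank_le _ hi]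
  lift i to Fin (finrank 𝕜 E) using hi
  obtain ⟨b, hb⟩ := exists_orthonormalBasis_isRightSingularFamily T
  obtain ⟨c, hc⟩ := exists_orthonormalBasis_isRightSingularFamily S
  -- `x ⟂ b j` for `j > i` and `x ⟂ c j` for `j < i`: one condition fewer than the dimension.
  obtain ⟨x, hx0, hx⟩ := exists_ne_zero_forall_inner_eq_zero (𝕜 := 𝕜)
    (fun j : {j // j ≠ i} => if i < j then b j else c j) (by simp [i.pos])
  have hT : T.singularValues i * ‖x‖ ≤ ‖T x‖ :=
    hb.singularValues_mul_norm_le i fun j hj => by simpa [hj] using hx ⟨j, hj.ne'⟩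
  have hS : ‖S x‖ ≤ S.singularValues i * ‖x‖ :=
    hc.norm_apply_le i fun j hj => by simpa [hj.not_gt] using hx ⟨j, hj.ne⟩
  refine le_of_mul_le_mul_right ?_ (norm_pos_iff.2 hx0)
  calc T.singularValues i * ‖x‖ ≤ ‖S x + (T - S) x‖ := by simpa using hT
    _ ≤ ‖S x‖ + ‖(T - S) x‖ := norm_add_le _ _
    _ ≤ S.singularValues i * ‖x‖ + ‖T - S‖ * ‖x‖ := add_le_add hS ((T - S).le_opNorm x)
    _ = (S.singularValues i + ‖T - S‖) * ‖x‖ := (add_mul _ _ _).symm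

theorem lipschitzWith_singularValues (i : ℕ) :
    LipschitzWith 1 fun T : E →L[𝕜] F => T.singularValues i :=
  LipschitzWith.of_le_add fun T S => by
    simpa [dist_eq_norm] using singularValues_le_add_norm_sub T S i

theorem isClosed_setOf_isRightSingularFamily (k : ℕ) :
    IsClosed {z : (E →L[𝕜] F) × (Fin k → E) | IsRightSingularFamily z.1 z.2} := by
  have hsv : ∀ i, Continuous fun T : E →L[𝕜] F => T.singularValues i :=
    fun i => (lipschitzWith_singularValues i).continuous
  have hsplit : {z : (E →L[𝕜] F) × (Fin k → E) | IsRightSingularFamily z.1 z.2} =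
      (Prod.snd ⁻¹' {v | Orthonormal 𝕜 v}) ∩ ⋂ i, ⋂ x, {z : (E →L[𝕜] F) × (Fin k → E) |
        ⟪z.1 (z.2 i), z.1 x⟫_𝕜 = ((z.1.singularValues i ^ 2 : ℝ) : 𝕜) * ⟪z.2 i, x⟫_𝕜} := by
    ext z
    simp only [mem_inter_iff, mem_preimage, mem_iInter, mem_ofPred_eq]
    exact ⟨fun h => ⟨h.1, h.2⟩, fun h => ⟨h.1, h.2⟩⟩
  rw [hsplit]
  refine ((isCompact_setOf_orthonormal 𝕜 (Fin k)).isClosed.preimage continuous_snd).inter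
    (isClosed_iInter fun i => isClosed_iInter fun x => isClosed_eq (by fun_prop) ?_)
  exact (RCLike.continuous_ofReal.comp (((hsv i).comp continuous_fst).pow 2)).mul (by fun_prop)

theorem sum_norm_apply_rpow_le (T : E →L[𝕜] F) {k : ℕ} {v : Fin k → E} (hv : Orthonormal 𝕜 v)
    {p : ℝ} (hp : 2 ≤ p) :
    ∑ i, ‖T (v i)‖ ^ p ≤ ∑ i ∈ Finset.range k, T.singularValues i ^ p := by
  obtain ⟨b, hb⟩ := exists_orthonormalBasis_isRightSingularFamily T
  have hsq_rpow : ∀ a : ℝ, 0 ≤ a → (a ^ 2) ^ (p / 2) = a ^ p := fun a ha => by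
    rw [← Real.rpow_natCast, ← Real.rpow_mul ha]
    ring_nf
  have hjensen : ∀ i, ‖T (v i)‖ ^ p ≤
      ∑ j : Fin (finrank 𝕜 E), T.singularValues j ^ p * ‖⟪b j, v i⟫_𝕜‖ ^ 2 := fun i => by
    have h := Real.rpow_arith_mean_le_arith_mean_rpow Finset.univ
      (fun j => ‖⟪b j, v i⟫_𝕜‖ ^ 2) (fun j => T.singularValues j ^ 2)
      (fun j _ => by positivity) (by rw [b.sum_sq_norm_inner_right, hv.1 i, one_pow])
      (fun j _ => by positivity) (p := p / 2) (by linarith)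
    simpa only [mul_comm, ← hb.norm_sq_apply_eq_sum, hsq_rpow _ (norm_nonneg _),
      hsq_rpow _ (T.toLinearMap.singularValues_nonneg _)] using h
  refine (Finset.sum_le_sum fun i _ => hjensen i).trans ?_
  rw [Finset.sum_comm]
  simp only [← Finset.mul_sum]
  refine sum_mul_le_sum_range_of_antitone (s := fun j => T.singularValues j ^ p) (fun i j hij => ?_)
    (fun j => Finset.sum_nonneg fun i _ => by positivity) (fun j => ?_) ?_
  · exact Real.rpow_le_rpow (T.toLinearMap.singularValues_nonneg j)
      (T.toLinearMap.singularValues_antitone hij) (by linarith)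
  · have := hv.sum_inner_products_le (b j) (s := Finset.univ)
    simpa only [norm_inner_symm (b j), b.orthonormal.1 j, one_pow] using this
  · rw [Finset.sum_comm]
    simp [b.sum_sq_norm_inner_right, hv.1]

theorem IsRightSingularFamily.sum_re_inner_nonneg {R S : E →L[𝕜] F} {k : ℕ} {v : Fin k → E}
    (hv : IsRightSingularFamily R v) {p : ℝ} (hp : 2 ≤ p)
    (hle : ∑ i ∈ Finset.range k, (R - S).singularValues i ^ p ≤
      ∑ i ∈ Finset.range k, R.singularValues i ^ p) :
    0 ≤ ∑ i : Fin k, R.singularValues i ^ (p - 2) * RCLike.re ⟪R (v i), S (v i)⟫_𝕜 := by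
  have hsum : ∑ i, ‖R (v i)‖ ^ p = ∑ i ∈ Finset.range k, R.singularValues i ^ p := by
    simp only [hv.norm_apply]
    exact Fin.sum_univ_eq_sum_range (fun i => R.singularValues i ^ p) k
  have hdiff : 0 ≤ ∑ i, (‖R (v i)‖ ^ p - ‖R (v i) - S (v i)‖ ^ p) := by
    rw [Finset.sum_sub_distrib, hsum, sub_nonneg]
    exact (sum_norm_apply_rpow_le (R - S) hv.orthonormal hp).trans hle
  have hgrad := hdiff.trans (Finset.sum_le_sum fun i _ =>
    norm_rpow_sub_norm_sub_rpow_le (𝕜 := 𝕜) (by linarith : 1 ≤ p) (R (v i)) (S (v i)))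
  rw [← Finset.mul_sum] at hgrad
  simpa only [hv.norm_apply] using nonneg_of_mul_nonneg_right hgrad (by linarith)

theorem isClosed_setOf_exists_sum_re_inner_nonneg (S : E →L[𝕜] F) (k : ℕ) {q : ℝ} (hq : 0 ≤ q) :
    IsClosed {T : E →L[𝕜] F | ∃ v : Fin k → E, IsRightSingularFamily T v ∧
      0 ≤ ∑ i : Fin k, T.singularValues i ^ q * RCLike.re ⟪T (v i), S (v i)⟫_𝕜} := by
  let 𝒪 : Set (Fin k → E) := {v | Orthonormal 𝕜 v}
  have : CompactSpace 𝒪 := isCompact_iff_compactSpace.1 (isCompact_setOf_orthonormal 𝕜 (Fin k))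
  let C : Set ((E →L[𝕜] F) × 𝒪) := {z | IsRightSingularFamily z.1 z.2.1} ∩
    {z | 0 ≤ ∑ i : Fin k, z.1.singularValues i ^ q * RCLike.re ⟪z.1 (z.2.1 i), S (z.2.1 i)⟫_𝕜}
  have hC : IsClosed C := by
    have hval : Continuous fun z : (E →L[𝕜] F) × 𝒪 => (z.1, (z.2 : Fin k → E)) :=
      continuous_fst.prodMk (continuous_subtype_val.comp continuous_snd)
    refine ((isClosed_setOf_isRightSingularFamily k).preimage hval).inter
      (isClosed_le continuous_const (continuous_finsetSum _ fun i _ => Continuous.mul ?_ ?_))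
    · exact ((lipschitzWith_singularValues _).continuous.comp continuous_fst).rpow_const
        fun _ => Or.inr hq
    · have hvi := (continuous_apply i).comp (continuous_snd.comp hval)
      exact RCLike.continuous_re.comp
        ((continuous_fst.clm_apply hvi).inner (S.continuous.comp hvi))
  convert isClosedMap_fst_of_compactSpace C hC using 1
  ext T
  constructor
  · rintro ⟨v, hv, hsum⟩
    exact ⟨(T, ⟨v, hv.orthonormal⟩), ⟨hv, hsum⟩, rfl⟩
  · rintro ⟨⟨_, v⟩, hv, rfl⟩
    exact ⟨v, hv⟩

theorem exists_isRightSingularFamily_sum_re_inner_nonneg (T S : E →L[𝕜] F) {k : ℕ}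
    (hk : k ≤ finrank 𝕜 E) {p : ℝ} (hp : 2 ≤ p)
    (hmin : ∀ t : ℝ, 0 < t → ∑ i ∈ Finset.range k, T.singularValues i ^ p ≤
      ∑ i ∈ Finset.range k, (T + (t : 𝕜) • S).singularValues i ^ p) :
    ∃ v : Fin k → E, IsRightSingularFamily T v ∧
      0 ≤ ∑ i : Fin k, T.singularValues i ^ (p - 2) * RCLike.re ⟪T (v i), S (v i)⟫_𝕜 := by
  have hray : Tendsto (fun t : ℝ => T + (t : 𝕜) • S) (𝓝[>] 0) (𝓝 T) := by
    have hcont : Continuous fun t : ℝ => T + (t : 𝕜) • S := by fun_prop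
    simpa using (hcont.tendsto 0).mono_left nhdsWithin_le_nhds
  refine (isClosed_setOf_exists_sum_re_inner_nonneg S k (sub_nonneg.2 hp)).mem_of_tendsto hray ?_
  filter_upwards [self_mem_nhdsWithin] with t (ht : 0 < t)
  obtain ⟨v, hv⟩ := exists_isRightSingularFamily (T + (t : 𝕜) • S) hk
  have h := hv.sum_re_inner_nonneg (S := (t : 𝕜) • S) hp (by simpa using hmin t ht)
  simp only [smul_apply, inner_smul_right, RCLike.re_ofReal_mul, mul_left_comm _ t,
    ← Finset.mul_sum] at h
  exact ⟨v, hv, nonneg_of_mul_nonneg_right h ht⟩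

end SingularValues

section Matrix

variable {m n k : ℕ}

theorem cfc_mul_of_mul_eq_smul {𝕜 ι : Type*} [RCLike 𝕜] [Fintype ι] [DecidableEq ι]
    {H T : Matrix ι ι 𝕜} (hH : H.IsHermitian) {c : ℝ} (h : H * T = c • T) (f : ℝ → ℝ) :
    cfc f H * T = f c • T := by
  obtain ⟨U, d, hUU, hUU', hcfc⟩ : ∃ (U : Matrix ι ι 𝕜) (d : ι → ℝ), star U * U = 1 ∧
      U * star U = 1 ∧ ∀ g : ℝ → ℝ,
        cfc g H = U * Matrix.diagonal (RCLike.ofReal ∘ g ∘ d) * star U :=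
    ⟨hH.eigenvectorUnitary, hH.eigenvalues, Unitary.coe_star_mul_self _,
      Unitary.coe_mul_star_self _, fun g => by
        rw [hH.cfc_eq, Matrix.IsHermitian.cfc, Unitary.conjStarAlgAut_apply]⟩
  have hrotate : ∀ g : ℝ → ℝ, star U * (cfc g H * T) =
      Matrix.diagonal (RCLike.ofReal ∘ g ∘ d) * (star U * T) := fun g => by
    rw [hcfc, Matrix.mul_assoc U, Matrix.mul_assoc U, ← Matrix.mul_assoc (star U), hUU,
      Matrix.one_mul, Matrix.mul_assoc]
  have hid : c • (star U * T) = Matrix.diagonal (RCLike.ofReal ∘ id ∘ d) * (star U * T) := by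
    rw [← hrotate, cfc_id ℝ H hH.isSelfAdjoint, h, Matrix.mul_smul]
  have hdiag : star U * (cfc f H * T) = f c • (star U * T) := by
    rw [hrotate]
    ext i j
    have hij := congrFun₂ hid i j
    simp only [Matrix.diagonal_mul, Matrix.smul_apply, Function.comp_apply, id_eq,
      RCLike.real_smul_eq_coe_mul] at hij ⊢
    rcases mul_eq_mul_right_iff.1 hij with hc | h0
    · rw [RCLike.ofReal_injective hc]
    · rw [h0, mul_zero, mul_zero]
  calc cfc f H * T = U * (star U * (cfc f H * T)) := by
        rw [← Matrix.mul_assoc U, hUU', Matrix.one_mul]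
    _ = f c • T := by
        rw [hdiag, Matrix.mul_smul, ← Matrix.mul_assoc, hUU', Matrix.one_mul]

theorem exists_mem_orthogonalComplement (M : Submodule ℂ (Matrix (Fin m) (Fin n) ℂ))
    {K : Set (Matrix (Fin m) (Fin n) ℂ)} (hKc : IsCompact K) (hKv : Convex ℝ K)
    (h : ∀ B ∈ M, ∃ G ∈ K, 0 ≤ (Bᴴ * G).trace.re) : ∃ G ∈ K, G ∈ orthogonalComplement M := by
  let L : Matrix (Fin m) (Fin n) ℂ →ₗ[ℂ] EuclideanSpace ℂ (Fin n × Fin m) :=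
    (WithLp.linearEquiv 2 ℂ _).symm.toLinearMap ∘ₗ
      { toFun := Matrix.vec, map_add' := Matrix.vec_add, map_smul' := Matrix.vec_smul }
  have hL : ∀ B G, inner ℂ (L B) (L G) = (Bᴴ * G).trace := fun B G => by
    rw [EuclideanSpace.inner_eq_star_dotProduct, dotProduct_comm]
    exact Matrix.star_vec_dotProduct_vec B G
  obtain ⟨-, ⟨G, hG, rfl⟩, hGo⟩ := exists_mem_orthogonal_of_forall_re_inner_nonneg (M.map L)
    (hKc.image L.continuous_of_finiteDimensional) (hKv.linear_image (L.restrictScalars ℝ)) (by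
      rintro - ⟨B, hB, rfl⟩
      obtain ⟨G, hG, hBG⟩ := h B hB
      exact ⟨L G, ⟨G, hG, rfl⟩, by rwa [hL]⟩)
  refine ⟨G, hG, fun B hB => ?_⟩
  rw [← hL]
  exact (Submodule.mem_orthogonal _ _).1 hGo (L B) ⟨B, hB, rfl⟩

open scoped MatrixOrder Matrix.Norms.L2Operator in
theorem norm_apply_le_re_trace {𝕜 ι : Type*} [RCLike 𝕜] [Fintype ι] {T : Matrix ι ι 𝕜}
    (hT : T.PosSemidef) (i j : ι) : ‖T i j‖ ≤ RCLike.re T.trace := by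
  classical
  obtain ⟨C, rfl⟩ := CStarAlgebra.nonneg_iff_eq_star_mul_self.1 hT.nonneg
  rw [Matrix.star_eq_conjTranspose]
  let c : ι → EuclideanSpace 𝕜 ι := fun l => WithLp.toLp 2 (C.col l)
  have hgram : ∀ l l', (Cᴴ * C) l l' = ⟪c l, c l'⟫_𝕜 := fun l l' => by
    simp [c, Matrix.mul_apply, PiLp.inner_apply, mul_comm]
  have htrace : RCLike.re (Cᴴ * C).trace = ∑ l, ‖c l‖ ^ 2 := by
    simp [Matrix.trace, hgram]
  have hle : ∀ l, ‖c l‖ ^ 2 ≤ RCLike.re (Cᴴ * C).trace := fun l =>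
    htrace ▸ Finset.single_le_sum (fun l _ => sq_nonneg ‖c l‖) (Finset.mem_univ l)
  rw [hgram]
  refine (norm_inner_le_norm _ _).trans ?_
  linarith [two_mul_le_add_sq ‖c i‖ ‖c j‖, hle i, hle j]

/-- The density matrices supported on the eigenspace of `H` for the eigenvalue `c`. With
`H = Aᴴ * A` and `c = σᵢ(A)²` these are the candidates for `Tᵢ`. -/
def eigenDensityMatrices (H : Matrix (Fin n) (Fin n) ℂ) (c : ℝ) : Set (Matrix (Fin n) (Fin n) ℂ) :=
  {T | IsDensityMatrix T ∧ H * T = c • T}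

theorem convex_eigenDensityMatrices (H : Matrix (Fin n) (Fin n) ℂ) (c : ℝ) :
    Convex ℝ (eigenDensityMatrices H c) := by
  rintro T ⟨⟨hT, hTtr⟩, hTc⟩ T' ⟨⟨hT', hTtr'⟩, hTc'⟩ a b ha hb hab
  refine ⟨⟨(hT.smul ha).add (hT'.smul hb), ?_⟩, ?_⟩
  · rw [Matrix.trace_add, Matrix.trace_smul, Matrix.trace_smul, hTtr, hTtr', ← add_smul, hab,
      one_smul]
  · rw [Matrix.mul_add, Matrix.mul_smul, Matrix.mul_smul, hTc, hTc', smul_add, smul_comm a,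
      smul_comm b]

theorem isClosed_eigenDensityMatrices (H : Matrix (Fin n) (Fin n) ℂ) (c : ℝ) :
    IsClosed (eigenDensityMatrices H c) := by
  simp only [eigenDensityMatrices, IsDensityMatrix, Matrix.posSemidef_iff_dotProduct_mulVec,
    Matrix.IsHermitian, ofPred_and, ofPred_forall]
  exact (((isClosed_eq (by fun_prop) continuous_id).inter
    (isClosed_iInter fun x => isClosed_le continuous_const (by fun_prop))).inter
    (isClosed_eq (by fun_prop) continuous_const)).inter (isClosed_eq (by fun_prop) (by fun_prop))

theorem isCompact_eigenDensityMatrices (H : Matrix (Fin n) (Fin n) ℂ) (c : ℝ) :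
    IsCompact (eigenDensityMatrices H c) := by
  have hbox : IsCompact (univ.pi fun _ : Fin n => univ.pi fun _ : Fin n =>
      Metric.closedBall (0 : ℂ) 1) :=
    isCompact_univ_pi fun _ => isCompact_univ_pi fun _ => isCompact_closedBall _ _
  refine hbox.of_isClosed_subset (isClosed_eigenDensityMatrices H c) fun T hT i _ j _ => ?_
  simpa [hT.1.2] using norm_apply_le_re_trace hT.1.1 i j

theorem vecMulVec_mem_eigenDensityMatrices {H : Matrix (Fin n) (Fin n) ℂ} {c : ℝ}
    {x : EuclideanSpace ℂ (Fin n)} (hx : ‖x‖ = 1) (hH : H *ᵥ x.ofLp = c • x.ofLp) :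
    Matrix.vecMulVec x.ofLp (star x.ofLp) ∈ eigenDensityMatrices H c := by
  refine ⟨⟨Matrix.posSemidef_vecMulVec_self_star _, ?_⟩, ?_⟩
  · rw [Matrix.trace_vecMulVec, ← EuclideanSpace.inner_eq_star_dotProduct,
      inner_self_eq_norm_sq_to_K, hx, RCLike.ofReal_one, one_pow]
  · rw [Matrix.mul_vecMulVec, hH, Matrix.smul_vecMulVec]

theorem sum_singularValue_rpow_le_of_pkNorm_le {p : ℝ} (hp : 0 < p)
    {A B : Matrix (Fin m) (Fin n) ℂ} (h : pkNorm p k A ≤ pkNorm p k B) :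
    ∑ i ∈ Finset.range k, singularValue A i ^ p ≤ ∑ i ∈ Finset.range k, singularValue B i ^ p := by
  have hnonneg : ∀ C : Matrix (Fin m) (Fin n) ℂ, 0 ≤ ∑ i ∈ Finset.range k, singularValue C i ^ p :=
    fun C => Finset.sum_nonneg fun i _ => Real.rpow_nonneg (LinearMap.singularValues_nonneg _ i) p
  exact (Real.rpow_le_rpow_iff (hnonneg A) (hnonneg B) (by positivity)).1 h

theorem trace_conjTranspose_mul_mul_vecMulVec (A B : Matrix (Fin m) (Fin n) ℂ)
    (x : EuclideanSpace ℂ (Fin n)) :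
    (Bᴴ * (A * Matrix.vecMulVec x.ofLp (star x.ofLp))).trace =
      ⟪B.toEuclideanLin x, A.toEuclideanLin x⟫_ℂ := by
  rw [Matrix.mul_vecMulVec, Matrix.mul_vecMulVec, Matrix.trace_vecMulVec,
    ← LinearMap.adjoint_inner_right, EuclideanSpace.inner_eq_star_dotProduct,
    ← Matrix.toEuclideanLin_conjTranspose_eq_adjoint]
  rfl

theorem conjTranspose_mul_self_mulVec {A : Matrix (Fin m) (Fin n) ℂ}
    {v : Fin k → EuclideanSpace ℂ (Fin n)}
    (hv : IsRightSingularFamily A.toEuclideanLin.toContinuousLinearMap v) (i : Fin k) :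
    (Aᴴ * A) *ᵥ (v i).ofLp = (singularValue A i ^ 2) • (v i).ofLp := by
  have heig : A.toEuclideanLin.adjoint (A.toEuclideanLin (v i)) =
      ((singularValue A i ^ 2 : ℝ) : ℂ) • v i := by
    refine ext_inner_right ℂ fun x => ?_
    rw [LinearMap.adjoint_inner_left, inner_smul_left, Complex.conj_ofReal]
    exact hv.inner_apply i x
  rw [← Matrix.toEuclideanLin_conjTranspose_eq_adjoint] at heig
  rw [← Matrix.mulVec_mulVec, ← Complex.coe_smul]
  exact congrArg WithLp.ofLp heig

theorem exists_eigenDensityMatrices_re_trace_nonneg {p : ℝ} (hp : 2 ≤ p) (hk : k ≤ n)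
    {A B : Matrix (Fin m) (Fin n) ℂ}
    (hmin : ∀ t : ℝ, 0 < t → pkNorm p k A ≤ pkNorm p k (A + (t : ℂ) • B)) :
    ∃ T : Fin k → Matrix (Fin n) (Fin n) ℂ,
      (∀ i : Fin k, T i ∈ eigenDensityMatrices (Aᴴ * A) (singularValue A i ^ 2)) ∧
      0 ≤ (Bᴴ * (A * matrixPow (Aᴴ * A) ((p - 2) / 2) * ∑ i, T i)).trace.re := by
  obtain ⟨v, hv, hsum⟩ := exists_isRightSingularFamily_sum_re_inner_nonneg
    A.toEuclideanLin.toContinuousLinearMap B.toEuclideanLin.toContinuousLinearMap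
    (k := k) (by simpa using hk) hp (fun t ht => by
      have h := sum_singularValue_rpow_le_of_pkNorm_le (by linarith) (hmin t ht)
      simp only [singularValue, map_add, map_smul] at h
      exact h)
  have hmem := fun i => vecMulVec_mem_eigenDensityMatrices (hv.orthonormal.1 i)
    (conjTranspose_mul_self_mulVec hv i)
  refine ⟨_, hmem, hsum.trans_eq ?_⟩
  have hpow : ∀ i, (singularValue A i ^ 2) ^ ((p - 2) / 2) = singularValue A i ^ (p - 2) :=
    fun i => by
      have hσ : 0 ≤ singularValue A i := LinearMap.singularValues_nonneg _ i
      rw [← Real.rpow_natCast, ← Real.rpow_mul hσ]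
      ring_nf
  simp only [Matrix.mul_assoc, Matrix.mul_sum, Matrix.trace_sum, Complex.re_sum]
  refine Finset.sum_congr rfl fun i _ => ?_
  rw [matrixPow, cfc_mul_of_mul_eq_smul (Matrix.isHermitian_conjTranspose_mul_self A) (hmem i).2,
    hpow, Matrix.mul_smul, Matrix.mul_smul, Matrix.trace_smul,
    trace_conjTranspose_mul_mul_vecMulVec, Complex.smul_re, ← inner_conj_symm,
    RCLike.conj_re, smul_eq_mul]
  rfl

end Matrix

end KyFan

theorem mainTheorem8 (m n k : ℕ) (p : ℝ) (hp : 2 ≤ p) (hk : 1 ≤ k) (hkn : k ≤ min m n)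
    (A : Matrix (Fin m) (Fin n) ℂ) (M : Submodule ℂ (Matrix (Fin m) (Fin n) ℂ))
    (hA : ∀ B ∈ M, KyFan.pkNorm p k A ≤ KyFan.pkNorm p k (A + B)) :
    ∃ T : Fin k → Matrix (Fin n) (Fin n) ℂ,
      (∀ i, KyFan.IsDensityMatrix (T i)) ∧
      (∀ i, Aᴴ * A * T i = (KyFan.singularValue A i ^ 2) • T i) ∧
      (1 / KyFan.pkNorm p k A ^ (p - 1)) •
          (A * KyFan.matrixPow (Aᴴ * A) ((p - 2) / 2) * ∑ i, T i) ∈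
        KyFan.orthogonalComplement M := by
  let 𝒟 : Set (Fin k → Matrix (Fin n) (Fin n) ℂ) := Set.univ.pi fun i =>
    KyFan.eigenDensityMatrices (Aᴴ * A) (KyFan.singularValue A i ^ 2)
  have h𝒟c : IsCompact 𝒟 := isCompact_univ_pi fun i => KyFan.isCompact_eigenDensityMatrices _ _
  have h𝒟v : Convex ℝ 𝒟 := convex_pi fun i _ => KyFan.convex_eigenDensityMatrices _ _
  let Φ : (Fin k → Matrix (Fin n) (Fin n) ℂ) →ₗ[ℝ] Matrix (Fin m) (Fin n) ℂ :=
    mulLeftLinearMap (Fin n) ℝ (A * KyFan.matrixPow (Aᴴ * A) ((p - 2) / 2)) ∘ₗ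
      ∑ i, LinearMap.proj i
  have hΦ : ∀ T, Φ T = A * KyFan.matrixPow (Aᴴ * A) ((p - 2) / 2) * ∑ i, T i := by
    simp [Φ, Matrix.mul_sum, Matrix.mul_assoc]
  obtain ⟨-, ⟨T, hT, rfl⟩, horth⟩ := KyFan.exists_mem_orthogonalComplement M
    (h𝒟c.image (Φ.continuous_of_finiteDimensional)) (h𝒟v.linear_image Φ) fun B hB => by
      obtain ⟨T, hT, hre⟩ := KyFan.exists_eigenDensityMatrices_re_trace_nonneg hp
        (hkn.trans (min_le_right m n)) fun t _ => hA ((t : ℂ) • B) (M.smul_mem _ hB)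
      exact ⟨Φ T, ⟨T, fun i _ => hT i, rfl⟩, by rwa [hΦ]⟩
  rw [hΦ] at horth
  exact ⟨T, fun i => (hT i trivial).1, fun i => (hT i trivial).2,
    Submodule.smul_of_tower_mem _ _ horth⟩
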